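/- Let $\Gamma$ be a countable infinite amenable (discrete) group with left regular representation $\lambda$ on $\ell^2(\Gamma)$, and let $C^*_r(\Gamma)\subset\mathbb B(\ell^2(\Gamma))$ be the C*-algebra generated by $\lambda(\Gamma)$. Suppose that $\Gamma$ has the C*-ISR property: every unital C*-subalgebra $\mathcal A\subseteq C^*_r(\Gamma)$ with $\lambda(g)\mathcal A\lambda(g)^*\subseteq\mathcal A$ for all $g\in\Gamma$ is of the form $C^*_r(N)=C^*(\lambda(N))$ for some normal subgroup $N\trianglelefteq\Gamma$. Then: 1. $C^*_r(\Gamma)$ has exactly one closed two-sided ideal other than $(0)$ and $C^*_r(\Gamma)$, namely the augmentation ideal $J_{\mathrm{Aug}}$, the closed two-sided ideal generated by $\{\lambda(g)-\lambda(e) : g\in\Gamma\}$. Moreover, there is a unital $*$-homomorphism $\varepsilon\colon C^*_r(\Gamma)\to\mathbb C$ with $\varepsilon(\lambda(g))=1$ for all $g\in\Gamma$ (the trivial representation), and $J_{\mathrm{Aug}}=\ker\varepsilon$. 2. The complex group ring $\mathbb C\Gamma$, with the involution $(\sum_g c_g g)^*=\sum_g\overline{c_g}\,g^{-1}$, has a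 unique C*-completion. That is, there is a C*-algebra $A$ with an injective unital $*$-homomorphism $\mathbb C\Gamma\to A$ of dense range, and for any two such pairs $(A,\iota)$ and $(B,\kappa)$ there is a $*$-isomorphism $e\colon A\to B$ with $e\circ\iota=\kappa$. -/

import Mathlib

universe u

open scoped ENNReal lp

noncomputable section

/-- A discrete group is amenable if `ℓ^∞(Γ, ℝ)` carries a left-invariant mean: a positive linear
functional of value `1` at the constant function `1` that takes equal values at `f` and at each
left translate `x ↦ f (g⁻¹ * x)` of `f`. -/
def IsAmenableGroup (Γ : Type u) [Group Γ] : Prop :=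
  ∃ m : ℓ^∞(Γ, ℝ) →ₗ[ℝ] ℝ,
    (∀ f : ℓ^∞(Γ, ℝ), (∀ x, 0 ≤ f x) → 0 ≤ m f) ∧
    m 1 = 1 ∧
    ∀ (g : Γ) (f f' : ℓ^∞(Γ, ℝ)), (∀ x, f' x = f (g⁻¹ * x)) → m f' = m f

section RegularRepresentation

variable {Γ : Type u} [Group Γ]

theorem memlp_two_translate (g : Γ) (ξ : ℓ²(Γ, ℂ)) :
    Memℓp (fun h : Γ => ξ (g⁻¹ * h)) 2 := by
  have h0 : 0 < (2 : ℝ≥0∞).toReal := by norm_num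
  exact memℓp_gen (((Equiv.mulLeft g⁻¹).summable_iff
    (f := fun h : Γ => ‖ξ h‖ ^ (2 : ℝ≥0∞).toReal)).2 ((lp.memℓp ξ).summable h0))

/-- Left translation `(λ_g ξ)(h) = ξ (g⁻¹ h)` as a linear isometry of `ℓ²(Γ)`. -/
def leftTranslation (g : Γ) : ℓ²(Γ, ℂ) →ₗᵢ[ℂ] ℓ²(Γ, ℂ) where
  toFun ξ := ⟨fun h => ξ (g⁻¹ * h), memlp_two_translate g ξ⟩
  map_add' _ _ := rfl
  map_smul' _ _ := rfl
  norm_map' ξ := by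
    have h0 : 0 < (2 : ℝ≥0∞).toReal := by norm_num
    rw [lp.norm_eq_tsum_rpow h0, lp.norm_eq_tsum_rpow h0]
    exact congrArg (· ^ (1 / (2 : ℝ≥0∞).toReal)) ((Equiv.mulLeft g⁻¹).tsum_eq
      (fun h : Γ => ‖ξ h‖ ^ (2 : ℝ≥0∞).toReal))

/-- The left regular representation `λ` of `Γ` by bounded operators on `ℓ²(Γ)`. -/
def leftRegular (Γ : Type u) [Group Γ] : Γ →* (ℓ²(Γ, ℂ) →L[ℂ] ℓ²(Γ, ℂ)) where
  toFun g := (leftTranslation g).toContinuousLinearMap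
  map_one' := by
    ext ξ h
    change ξ (1⁻¹ * h) = ξ h
    simp
  map_mul' a b := by
    ext ξ h
    change ξ ((a * b)⁻¹ * h) = ξ (b⁻¹ * (a⁻¹ * h))
    rw [mul_inv_rev, mul_assoc]

theorem leftRegular_apply (g : Γ) (ξ : ℓ²(Γ, ℂ)) (h : Γ) :
    leftRegular Γ g ξ h = ξ (g⁻¹ * h) := rfl

/-- For a subgroup `N` of `Γ`, the norm-closed unital star-subalgebra of `B(ℓ²(Γ))` generated by
`λ(N)`. This is the usual copy of `C*_r(N)` inside `C*_r(Γ)`. -/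
def reducedCStarOfSubgroup (N : Subgroup Γ) : StarSubalgebra ℂ (ℓ²(Γ, ℂ) →L[ℂ] ℓ²(Γ, ℂ)) :=
  (StarAlgebra.adjoin ℂ (leftRegular Γ '' (N : Set Γ))).topologicalClosure

/-- The reduced group C*-algebra `C*_r(Γ)`: the norm-closed star-subalgebra of `B(ℓ²(Γ))`
generated by the operators `λ(g)`, `g ∈ Γ`. -/
def reducedCStar (Γ : Type u) [Group Γ] : StarSubalgebra ℂ (ℓ²(Γ, ℂ) →L[ℂ] ℓ²(Γ, ℂ)) :=
  (StarAlgebra.adjoin ℂ (Set.range (leftRegular Γ))).topologicalClosure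

/-- The element `λ(g)` of `C*_r(Γ)`. -/
def reducedUnitary (g : Γ) : reducedCStar Γ :=
  ⟨leftRegular Γ g, StarSubalgebra.le_topologicalClosure _
    (StarAlgebra.subset_adjoin ℂ _ (Set.mem_range_self g))⟩

/-- The C*-ISR property: every (unital) C*-subalgebra of `C*_r(Γ)` which is invariant under
conjugation by all `λ(g)` is `C*_r(N)` for some normal subgroup `N` of `Γ`.
Here `λ(g⁻¹) = λ(g)⁻¹ = λ(g)*`. -/
def HasCStarISR (Γ : Type u) [Group Γ] : Prop :=
  ∀ A : StarSubalgebra ℂ (ℓ²(Γ, ℂ) →L[ℂ] ℓ²(Γ, ℂ)),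
    IsClosed (A : Set (ℓ²(Γ, ℂ) →L[ℂ] ℓ²(Γ, ℂ))) →
    A ≤ reducedCStar Γ →
    (∀ g : Γ, ∀ a ∈ A, leftRegular Γ g * a * leftRegular Γ g⁻¹ ∈ A) →
    ∃ N : Subgroup Γ, N.Normal ∧ A = reducedCStarOfSubgroup N

/-- The augmentation ideal of `C*_r(Γ)`: the smallest closed two-sided ideal that contains
`λ(g) - λ(e)` for all `g ∈ Γ`. -/
def augmentationIdeal (Γ : Type u) [Group Γ] : TwoSidedIdeal (reducedCStar Γ) :=
  sInf {I : TwoSidedIdeal (reducedCStar Γ) | IsClosed (I : Set (reducedCStar Γ)) ∧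
    ∀ g : Γ, reducedUnitary g - reducedUnitary 1 ∈ I}

end RegularRepresentation

section Completions

variable {Γ : Type u} [Group Γ]

/-- The involution of the complex group ring, `(∑ c_g g)* = ∑ conj(c_g) g⁻¹`. -/
def groupRingStar (x : MonoidAlgebra ℂ Γ) : MonoidAlgebra ℂ Γ :=
  x.coeff.sum fun g c => MonoidAlgebra.single g⁻¹ (star c)

/-- `ι : ℂΓ → A` exhibits the C*-algebra `A` as a C*-completion of the star-algebra `ℂΓ`, i.e. as
the completion of `ℂΓ` with respect to the C*-norm `x ↦ ‖ι x‖`: `ι` is an injective star-algebra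
homomorphism with dense range. -/
structure IsCStarCompletion {A : Type u} [CStarAlgebra A] (ι : MonoidAlgebra ℂ Γ →ₐ[ℂ] A) :
    Prop where
  map_star : ∀ x, ι (groupRingStar x) = star (ι x)
  injective : Function.Injective ι
  denseRange : DenseRange ι

/-- `ℂΓ` has a unique C*-completion: there is one, and any two are isomorphic as C*-algebras by an
isomorphism that is the identity on `ℂΓ`. -/
def HasUniqueCStarCompletion (Γ : Type u) [Group Γ] : Prop :=
  (∃ (A : Type u) (_ : CStarAlgebra A) (ι : MonoidAlgebra ℂ Γ →ₐ[ℂ] A), IsCStarCompletion ι) ∧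
  ∀ (A B : Type u) [CStarAlgebra A] [CStarAlgebra B]
    (ι : MonoidAlgebra ℂ Γ →ₐ[ℂ] A) (κ : MonoidAlgebra ℂ Γ →ₐ[ℂ] B),
    IsCStarCompletion ι → IsCStarCompletion κ →
    ∃ e : A ≃⋆ₐ[ℂ] B, ∀ x, e (ι x) = κ x

end Completions

end

/-!
Two facts carry the theorem.

*Ideals.* Let `I` be a proper nonzero closed two-sided ideal of `C*_r(Γ)`. Closed ideals are
self-adjoint, so `ℂ1 + I` is an invariant C*-subalgebra and, by the C*-ISR property, equals
`C*_r(N)` for a normal subgroup `N`, which is nontrivial because `I` is proper and nonzero. For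
`n ≠ e` in `N` some `λ(n) - c` lies in `I`, hence so does `λ(gn) - c λ(g)` for every `g`. This
operator belongs to `C*_r(N)` only if `g ∈ N`, since operators in `C*_r(N)` preserve `ℓ²(N)`. Thus
`N = Γ`, and `I` has codimension one (`HasCStarISR.exists_sub_algebraMap_mem`). The intersection of
`I` with the augmentation ideal has codimension at most two, hence is nonzero because `Γ` is
infinite; being proper, it has codimension one itself, and therefore equals both ideals
(`eq_augmentationIdeal`).

*Amenability.* Every star-representation of `ℂΓ` in a C*-algebra is dominated by the regular one
(`IsAmenableGroup.norm_sum_le`). A separation argument turns the invariant mean into almost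
invariant finitely supported densities, whose square roots give unit vectors `ξ` of `ℓ²(Γ)` with
coefficients `⟨λ(g) ξ, ξ⟩` close to `1`. Fell's absorption principle, here an inequality between
Gram matrices with entries in the C*-algebra, bounds a representation multiplied by such a
coefficient by the regular representation; the coefficients tend to `1`.

Consequently the trivial representation extends to `C*_r(Γ)`, with the augmentation ideal as its
kernel, and `C*_r(Γ)` maps onto every C*-completion of `ℂΓ`. The kernel of the latter map is a
closed ideal that meets `ℂΓ` trivially, so it vanishes by the classification of ideals, and
`C*_r(Γ)` is the only completion.
-/

noncomputable section

/-! ### Almost invariant vectors -/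

section AlmostInvariantVectors

open scoped Classical

variable {Γ : Type u} [Group Γ]

/-- The finitely supported functions as elements of `ℓ¹(Γ)`. -/
def finsuppToL1 (α : Type u) : (α →₀ ℝ) →ₗ[ℝ] lp (fun _ : α => ℝ) 1 :=
  Finsupp.lsum ℝ fun h => lp.lsingle (𝕜 := ℝ) (E := fun _ : α => ℝ) 1 h

theorem finsuppToL1_apply {α : Type u} (f : α →₀ ℝ) (h : α) : finsuppToL1 α f h = f h := by
  induction f using Finsupp.induction_linear with
  | zero => simp
  | add f g hf hg => simp [map_add, hf, hg]
  | single a c =>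
    by_cases hah : a = h
    · subst hah
      simp [finsuppToL1]
    · have : h ≠ a := Ne.symm hah
      simp [finsuppToL1, this]

theorem norm_finsuppToL1 {α : Type u} (f : α →₀ ℝ) : ‖finsuppToL1 α f‖ = ∑' h, |f h| := by
  rw [lp.norm_eq_tsum_rpow (by norm_num)]
  simp [finsuppToL1_apply]

/-- The linear map `f ↦ (g f - f)_{g ∈ S}` from finitely supported functions to `ℓ¹(Γ)^S`, where
`(g f)(h) = f (g⁻¹ h)`. -/
def translationDefect (S : Finset Γ) :
    (Γ →₀ ℝ) →ₗ[ℝ] (S → lp (fun _ : Γ => ℝ) 1) :=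
  LinearMap.pi fun g => finsuppToL1 Γ ∘ₗ
    (Finsupp.lmapDomain ℝ ℝ (fun h => (g : Γ) * h) - LinearMap.id)

theorem mapDomain_mulLeft_apply (g : Γ) (f : Γ →₀ ℝ) (h : Γ) :
    Finsupp.mapDomain (fun h => g * h) f h = f (g⁻¹ * h) := by
  have := Finsupp.mapDomain_apply (mul_right_injective g) f (g⁻¹ * h)
  simpa using this

theorem norm_translationDefect_apply (S : Finset Γ) (f : Γ →₀ ℝ) (g : S) :
    ‖translationDefect S f g‖ = ∑' h, |f ((g : Γ)⁻¹ * h) - f h| := by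
  have : translationDefect S f g =
      finsuppToL1 Γ (Finsupp.mapDomain (fun h => (g : Γ) * h) f - f) := by
    simp [translationDefect]
  simp [this, norm_finsuppToL1, mapDomain_mulLeft_apply, -map_sub]

/-- Averaging any bounded functional against an invariant mean shows that the translation defects
of the point masses cannot be separated from `0`. -/
theorem IsAmenableGroup.not_forall_lt (hamen : IsAmenableGroup Γ) (S : Finset Γ)
    (Λ : (S → lp (fun _ : Γ => ℝ) 1) →L[ℝ] ℝ) {u : ℝ} (hu : 0 < u) :
    ¬ ∀ h : Γ, u < Λ (translationDefect S (Finsupp.single h 1)) := by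
  intro hlt
  obtain ⟨m, hpos, hone, hinv⟩ := hamen
  let φ : S → Γ → ℝ := fun g h => Λ (Pi.single g (finsuppToL1 Γ (Finsupp.single h 1)))
  have hφ : ∀ g h, |φ g h| ≤ ‖Λ‖ := fun g h => by
    refine (Λ.le_opNorm _).trans ?_
    have : ‖finsuppToL1 Γ (Finsupp.single h 1)‖ = 1 := by
      simp [finsuppToL1]
    rw [Pi.norm_single, this, mul_one]
  have hmem : ∀ (g : S) (k : Γ), Memℓp (fun h => φ g (k * h)) ∞ := fun g k =>
    memℓp_infty ⟨‖Λ‖, by rintro _ ⟨h, rfl⟩; exact hφ g _⟩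
  let F : S → ℓ^∞(Γ, ℝ) := fun g => ⟨fun h => φ g (1 * h), hmem g 1⟩
  let F' : S → ℓ^∞(Γ, ℝ) := fun g => ⟨fun h => φ g (g * h), hmem g g⟩
  have hFF : ∀ g, m (F' g) = m (F g) := fun g =>
    hinv (g : Γ)⁻¹ (F g) (F' g) fun x => by
      change φ g (g * x) = φ g (1 * ((g : Γ)⁻¹⁻¹ * x))
      simp
  have hsum : ∀ h, Λ (translationDefect S (Finsupp.single h 1)) =
      ∑ g, (φ g (g * h) - φ g (1 * h)) := fun h => by
    rw [← Finset.univ_sum_single (translationDefect S (Finsupp.single h 1)), map_sum]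
    refine Finset.sum_congr rfl fun g _ => ?_
    simp only [φ, ← map_sub, ← Pi.single_sub, one_mul]
    simp [translationDefect, Finsupp.mapDomain_single]
  have h0 := hpos (∑ g, (F' g - F g) - u • 1) fun h => by
    have := hlt h
    rw [hsum] at this
    have e : (∑ g, (F' g - F g) - u • (1 : ℓ^∞(Γ, ℝ))) h =
        ∑ g, (φ g (g * h) - φ g (1 * h)) - u := by
      rw [← lp.evalₗ_apply (𝕜 := ℝ), map_sub, map_sum, map_smul]
      simp only [map_sub]
      change ∑ g, (φ g (g * h) - φ g (1 * h)) - u * 1 = _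
      rw [mul_one]
    rw [e]
    linarith
  simp [map_sub, map_sum, hFF, hone] at h0
  linarith

/-- Reiter's condition: an amenable group has finitely supported probability densities that are
almost invariant in `ℓ¹` under any given finite set. -/
theorem IsAmenableGroup.exists_almost_invariant_density (hamen : IsAmenableGroup Γ)
    (S : Finset Γ) {ε : ℝ} (hε : 0 < ε) :
    ∃ f : Γ →₀ ℝ, (∀ h, 0 ≤ f h) ∧ ∑' h, f h = 1 ∧
      ∀ g ∈ S, ∑' h, |f (g⁻¹ * h) - f h| < ε := by
  let P : Set (Γ →₀ ℝ) := {f | (∀ h, 0 ≤ f h) ∧ f.sum (fun _ a => a) = 1}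
  have hsum : ∀ f : Γ →₀ ℝ, ∑' h, f h = f.sum (fun _ a => a) := fun f =>
    tsum_eq_sum fun h hh => by simpa using hh
  have hlin : ∀ f : Γ →₀ ℝ, f.sum (fun _ a => a) =
      Finsupp.lsum ℝ (fun _ => (LinearMap.id : ℝ →ₗ[ℝ] ℝ)) f := fun f => rfl
  have hP : Convex ℝ P := by
    rintro f ⟨hf, hf1⟩ g ⟨hg, hg1⟩ a b ha hb hab
    refine ⟨fun h => ?_, ?_⟩
    · simpa using add_nonneg (mul_nonneg ha (hf h)) (mul_nonneg hb (hg h))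
    · rw [hlin] at *
      rw [map_add, map_smul, map_smul, hf1, hg1]
      simpa using hab
  have h0 : (0 : S → lp (fun _ : Γ => ℝ) 1) ∈ closure (translationDefect S '' P) := by
    by_contra hcon
    obtain ⟨Λ, u, hu, hlt⟩ := geometric_hahn_banach_point_closed
      (hP.linear_image _).closure isClosed_closure hcon
    rw [map_zero] at hu
    refine hamen.not_forall_lt S Λ hu fun h => hlt _ (subset_closure ⟨_, ⟨fun k => ?_, ?_⟩, rfl⟩)
    · rw [Finsupp.single_apply]; split_ifs <;> norm_num
    · simp
  obtain ⟨_, ⟨f, ⟨hf, hf1⟩, rfl⟩, hd⟩ := Metric.mem_closure_iff.1 h0 ε hε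
  refine ⟨f, hf, by rw [hsum, hf1], fun g hg => ?_⟩
  rw [dist_zero_left] at hd
  rw [← norm_translationDefect_apply S f ⟨g, hg⟩]
  exact (norm_le_pi_norm _ _).trans_lt hd

/-- The matrix coefficient `g ↦ ⟨λ(g) ξ, ξ⟩` of a finitely supported real vector. -/
def regularCoefficient (ξ : Γ →₀ ℝ) (g : Γ) : ℝ := ∑' h, ξ (g⁻¹ * h) * ξ h

/-- The square roots of almost invariant densities are almost invariant unit vectors of `ℓ²`. -/
theorem IsAmenableGroup.exists_regularCoefficient_near_one (hamen : IsAmenableGroup Γ)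
    (S : Finset Γ) {ε : ℝ} (hε : 0 < ε) :
    ∃ ξ : Γ →₀ ℝ, ∑' h, ξ h ^ 2 = 1 ∧ ∀ g ∈ S, |regularCoefficient ξ g - 1| < ε := by
  obtain ⟨f, hf, hf1, hfS⟩ := hamen.exists_almost_invariant_density S hε
  let ξ : Γ →₀ ℝ := f.mapRange Real.sqrt Real.sqrt_zero
  have hξ : ∀ h, ξ h = √(f h) := fun h => rfl
  have hsq : ∀ h, ξ h ^ 2 = f h := fun h => Real.sq_sqrt (hf h)
  refine ⟨ξ, by simp only [hsq, hf1], fun g hg => ?_⟩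
  have hfin : ∀ (e : Γ → Γ), Function.Injective e → ∀ F : ℝ → Γ → ℝ, (∀ h, F 0 h = 0) →
      Summable fun h => F (ξ (e h)) h := fun e he F hF => by
    refine summable_of_hasFiniteSupport ((ξ.hasFiniteSupport.preimage he.injOn).subset ?_)
    intro h hh hc
    exact hh (by simp [show ξ (e h) = 0 from by simpa using hc, hF])
  have s1 : Summable fun h => ξ h ^ 2 := hfin id Function.injective_id (fun a _ => a ^ 2) (by simp)
  have s2 : Summable fun h => ξ (g⁻¹ * h) ^ 2 :=
    hfin _ (mul_right_injective g⁻¹) (fun a _ => a ^ 2) (by simp)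
  have s3 : Summable fun h => ξ (g⁻¹ * h) * ξ h :=
    hfin _ (mul_right_injective g⁻¹) (fun a h => a * ξ h) (by simp)
  have t1 : ∑' h, ξ h ^ 2 = 1 := by simp only [hsq, hf1]
  have t2 : ∑' h, ξ (g⁻¹ * h) ^ 2 = 1 :=
    ((Equiv.mulLeft g⁻¹).tsum_eq fun h => ξ h ^ 2).trans t1
  have s4 : Summable fun h => |f (g⁻¹ * h) - f h| := by
    simp only [← hsq]
    exact (s2.sub s1).abs
  have key : ∑' h, (ξ (g⁻¹ * h) - ξ h) ^ 2 = 2 - 2 * regularCoefficient ξ g := by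
    rw [regularCoefficient, ← tsum_mul_left]
    calc _ = ∑' h, (ξ (g⁻¹ * h) ^ 2 + ξ h ^ 2 - 2 * (ξ (g⁻¹ * h) * ξ h)) :=
          tsum_congr fun h => by ring
      _ = _ := by
          rw [(s2.add s1).tsum_sub (s3.mul_left 2), s2.tsum_add s1, t1, t2]; norm_num
  have s5 : Summable fun h => (ξ (g⁻¹ * h) - ξ h) ^ 2 := by
    refine ((s2.add s1).sub (s3.mul_left 2)).congr fun h => by ring
  have hle : ∑' h, (ξ (g⁻¹ * h) - ξ h) ^ 2 ≤ ∑' h, |f (g⁻¹ * h) - f h| := by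
    refine s5.tsum_le_tsum (fun h => ?_) s4
    -- `(a - b)² ≤ |a - b| (a + b) = |a² - b²|` for `a, b ≥ 0`
    rw [← hsq, ← hsq, sq_sub_sq, abs_mul, ← sq_abs (_ - _), sq, mul_comm |_ + _|]
    refine mul_le_mul_of_nonneg_left ?_ (abs_nonneg _)
    have a0 : 0 ≤ ξ (g⁻¹ * h) := Real.sqrt_nonneg _
    have b0 : 0 ≤ ξ h := Real.sqrt_nonneg _
    rw [abs_of_nonneg (add_nonneg a0 b0), abs_le]
    constructor <;> linarith
  -- so `0 ≤ 2 - 2 ⟨λ(g) ξ, ξ⟩ < ε`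
  have h0 : 0 ≤ ∑' h, (ξ (g⁻¹ * h) - ξ h) ^ 2 := tsum_nonneg fun h => sq_nonneg _
  have := hfS g hg
  rw [abs_lt]
  constructor <;> linarith

/-- Over an amenable group, the constant function `1` is a pointwise limit of coefficients of unit
vectors in the regular representation. -/
theorem IsAmenableGroup.one_mem_closure_regularCoefficient (hamen : IsAmenableGroup Γ) :
    (fun _ => 1) ∈ closure {p : Γ → ℝ | ∃ ξ : Γ →₀ ℝ, ∑' h, ξ h ^ 2 = 1 ∧
      p = regularCoefficient ξ} := by
  choose ξ hξ1 hξ using fun i : Finset Γ × ℕ =>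
    hamen.exists_regularCoefficient_near_one i.1 (Nat.one_div_pos_of_nat (α := ℝ) (n := i.2))
  refine mem_closure_of_tendsto (b := Filter.atTop) (f := fun i => regularCoefficient (ξ i)) ?_
    (Filter.Eventually.of_forall fun i => ⟨ξ i, hξ1 i, rfl⟩)
  refine tendsto_pi_nhds.2 fun g => Metric.tendsto_atTop.2 fun ε hε => ?_
  obtain ⟨n, hn⟩ := exists_nat_one_div_lt hε
  refine ⟨({g}, n), fun i hi => (hξ i g (hi.1 (Finset.mem_singleton_self g))).trans
    (lt_of_le_of_lt ?_ hn)⟩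
  exact Nat.one_div_le_one_div hi.2

end AlmostInvariantVectors

/-! ### Comparison with the regular representation -/

section GramMatrix

open scoped InnerProductSpace ComplexOrder MatrixOrder

/-- A positive semidefinite scalar matrix, being of the form `Bᴴ * B`, defines a positive
sesquilinear form on tuples of elements of a C*-algebra. -/
theorem Matrix.PosSemidef.sum_smul_star_mul_nonneg {n A : Type*} [Fintype n] [CStarAlgebra A]
    [PartialOrder A] [StarOrderedRing A] {M : Matrix n n ℂ} (hM : M.PosSemidef) (v : n → A) :
    0 ≤ ∑ j, ∑ k, M j k • (star (v j) * v k) := by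
  classical
  obtain ⟨B, rfl⟩ := CStarAlgebra.nonneg_iff_eq_star_mul_self.mp hM.nonneg
  have : ∑ j, ∑ k, (star B * B) j k • (star (v j) * v k) =
      ∑ i, star (∑ j, B i j • v j) * ∑ k, B i k • v k := by
    simp only [Matrix.mul_apply, Matrix.star_apply, star_sum, star_smul, Finset.sum_mul_sum,
      Finset.sum_smul, smul_mul_smul_comm]
    exact (Finset.sum_congr rfl fun j _ => Finset.sum_comm).trans Finset.sum_comm
  rw [this]
  exact Finset.sum_nonneg fun i _ => star_mul_self_nonneg _

/-- The inequality `‖(T ⊗ 1) ∑ eⱼ ⊗ vⱼ‖² ≤ ‖T‖² ‖∑ eⱼ ⊗ vⱼ‖²` in the Hilbert module `E ⊗ A`, written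
with Gram matrices. -/
theorem Orthonormal.sum_inner_smul_star_mul_le {n A E E' : Type*} [Fintype n] [CStarAlgebra A]
    [PartialOrder A] [StarOrderedRing A] [NormedAddCommGroup E] [InnerProductSpace ℂ E]
    [NormedAddCommGroup E'] [InnerProductSpace ℂ E'] {e : n → E} (he : Orthonormal ℂ e)
    (T : E →L[ℂ] E') (v : n → A) :
    ∑ j, ∑ k, ⟪T (e j), T (e k)⟫_ℂ • (star (v j) * v k) ≤
      ((‖T‖ ^ 2 : ℝ) : ℂ) • ∑ j, star (v j) * v j := by
  classical
  let M : Matrix n n ℂ := fun j k => ((‖T‖ ^ 2 : ℝ) : ℂ) * (if j = k then 1 else 0) -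
    ⟪T (e j), T (e k)⟫_ℂ
  have hM : M.PosSemidef := by
    refine .of_dotProduct_mulVec_nonneg ?_ fun a => ?_
    · ext j k
      rw [Matrix.conjTranspose_apply]
      by_cases h : j = k <;> simp [M, h, eq_comm]
    · have h1 : star a ⬝ᵥ M.mulVec a =
          ((‖T‖ ^ 2 * ‖∑ j, a j • e j‖ ^ 2 - ‖T (∑ j, a j • e j)‖ ^ 2 : ℝ) : ℂ) := by
        have h2 : ⟪T (∑ j, a j • e j), T (∑ j, a j • e j)⟫_ℂ =
            ∑ j, ∑ k, star (a j) * (⟪T (e j), T (e k)⟫_ℂ * a k) := by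
          rw [map_sum, sum_inner]
          refine Finset.sum_congr rfl fun j _ => ?_
          rw [inner_sum]
          refine Finset.sum_congr rfl fun k _ => ?_
          rw [map_smul, map_smul, inner_smul_left, inner_smul_right, starRingEnd_apply]
          ring
        have h3 := he.inner_sum a a Finset.univ
        rw [inner_self_eq_norm_sq_to_K] at h2 h3
        push_cast
        simp only [Complex.coe_algebraMap] at h2 h3
        rw [h2, h3, Finset.mul_sum, ← Finset.sum_sub_distrib]
        simp only [dotProduct, Matrix.mulVec, Finset.mul_sum]
        refine Finset.sum_congr rfl fun j _ => ?_
        simp [M, sub_mul, mul_sub, Finset.sum_sub_distrib]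
        ring
      rw [h1]
      have := T.le_opNorm (∑ j, a j • e j)
      have h2 := pow_le_pow_left₀ (norm_nonneg _) this 2
      rw [mul_pow] at h2
      exact_mod_cast sub_nonneg.2 h2
  have := hM.sum_smul_star_mul_nonneg v
  simpa [M, sub_smul, Finset.sum_sub_distrib, mul_smul, ite_smul, Finset.smul_sum] using this

end GramMatrix

section RegularNorm

open scoped InnerProductSpace Classical

variable {Γ : Type u}

/-- The point mass at `h`, as a vector of `ℓ²(Γ)`. -/
def pointMass (h : Γ) : ℓ²(Γ, ℂ) := lp.single 2 h (1 : ℂ)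

theorem pointMass_apply (h k : Γ) : pointMass h k = if k = h then 1 else 0 := by
  simp [pointMass, Pi.single_apply]

theorem inner_pointMass (h k : Γ) : ⟪pointMass h, pointMass k⟫_ℂ = if h = k then 1 else 0 := by
  rw [pointMass, lp.inner_single_left]
  simp [pointMass_apply]

theorem orthonormal_pointMass : Orthonormal ℂ (pointMass : Γ → ℓ²(Γ, ℂ)) :=
  orthonormal_iff_ite.2 inner_pointMass

variable [Group Γ]

theorem leftRegular_pointMass (g h : Γ) : leftRegular Γ g (pointMass h) = pointMass (g * h) := by
  ext k
  rw [leftRegular_apply, pointMass_apply, pointMass_apply]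
  simp only [inv_mul_eq_iff_eq_mul]

/-- Only the pairs `(j, k)` with `j k⁻¹ = g⁻¹ g'` contribute, and their weights add up to a
coefficient of the regular representation. -/
theorem sum_ite_smul_translate {A : Type*} [CStarAlgebra A] (π : Γ →* A)
    (hπ : ∀ g, star (π g) = π g⁻¹) (ξ : Γ →₀ ℝ) (g g' : Γ) :
    ∑ j ∈ ξ.support, ∑ k ∈ ξ.support, (if g * j = g' * k then (1 : ℂ) else 0) •
      (star ((ξ j : ℂ) • π j⁻¹) * ((ξ k : ℂ) • π k⁻¹)) =
    (regularCoefficient ξ (g'⁻¹ * g) : ℂ) • π (g⁻¹ * g') := by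
  have h1 : ∀ k, ∑ j ∈ ξ.support, (if g * j = g' * k then (1 : ℂ) else 0) •
      (star ((ξ j : ℂ) • π j⁻¹) * ((ξ k : ℂ) • π k⁻¹)) =
      ((ξ ((g'⁻¹ * g)⁻¹ * k) * ξ k : ℝ) : ℂ) • π (g⁻¹ * g') := fun k => by
    have he : ∀ j, g * j = g' * k ↔ j = (g'⁻¹ * g)⁻¹ * k := fun j => by
      rw [mul_inv_rev, inv_inv, mul_assoc, eq_inv_mul_iff_mul_eq]
    simp only [he, ite_smul, one_smul, zero_smul, Finset.sum_ite_eq']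
    split_ifs with hm
    · rw [star_smul, hπ, inv_inv, smul_mul_smul_comm, ← map_mul]
      simp [mul_assoc]
    · rw [Finsupp.notMem_support_iff.1 hm]
      simp
  rw [Finset.sum_comm]
  simp only [h1]
  rw [← Finset.sum_smul, ← Complex.ofReal_sum, regularCoefficient, tsum_eq_sum]
  intro k hk
  rw [Finsupp.notMem_support_iff.1 hk, mul_zero]

/-- A quantitative form of Fell's absorption principle: a unitary representation `π`, multiplied by
the coefficient of a unit vector in the regular representation, is dominated by the regular
representation. It is the Gram inequality for the tuple `vₖ = ξ(k) π(k)*`. -/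
theorem sum_regularCoefficient_smul_le {A : Type*} [CStarAlgebra A] [PartialOrder A]
    [StarOrderedRing A] (π : Γ →* A) (hπ : ∀ g, star (π g) = π g⁻¹) (c : Γ →₀ ℂ) (ξ : Γ →₀ ℝ)
    (hξ : ∑' h, ξ h ^ 2 = 1) :
    ∑ g ∈ c.support, ∑ g' ∈ c.support,
      (star (c g) * c g' * (regularCoefficient ξ (g'⁻¹ * g) : ℂ)) • π (g⁻¹ * g') ≤
    ((‖∑ g ∈ c.support, c g • leftRegular Γ g‖ ^ 2 : ℝ) : ℂ) • (1 : A) := by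
  set T := ∑ g ∈ c.support, c g • leftRegular Γ g with hT
  let v : Γ → A := fun k => (ξ k : ℂ) • π k⁻¹
  have gram := (orthonormal_pointMass.comp _ Subtype.val_injective).sum_inner_smul_star_mul_le T
    (fun k : ξ.support => v k)
  have hv : ∑ k : ξ.support, star (v k) * v k = 1 := by
    have : ∀ k, star (v k) * v k = ((ξ k ^ 2 : ℝ) : ℂ) • (1 : A) := fun k => by
      simp only [v]
      rw [star_smul, hπ, inv_inv, smul_mul_smul_comm, ← map_mul]
      simp [sq]
    rw [Finset.sum_coe_sort ξ.support (fun k => star (v k) * v k)]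
    simp only [this]
    rw [← Finset.sum_smul, ← Complex.ofReal_sum, ← tsum_eq_sum (L := .unconditional _), hξ]
    · simp
    · intro k hk
      rw [Finsupp.notMem_support_iff.1 hk]; norm_num
  have hinner : ∀ j k, ⟪T (pointMass j), T (pointMass k)⟫_ℂ =
      ∑ g ∈ c.support, ∑ g' ∈ c.support,
        star (c g) * c g' * (if g * j = g' * k then 1 else 0) := fun j k => by
    simp only [hT, sum_apply, smul_apply,
      leftRegular_pointMass]
    rw [sum_inner]
    refine Finset.sum_congr rfl fun g _ => ?_
    rw [inner_sum]
    refine Finset.sum_congr rfl fun g' _ => ?_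
    rw [inner_smul_left, inner_smul_right, inner_pointMass, starRingEnd_apply, mul_assoc]
  rw [hv] at gram
  refine le_of_eq_of_le ?_ gram
  calc _ = ∑ g ∈ c.support, ∑ g' ∈ c.support, (star (c g) * c g') •
        ∑ j ∈ ξ.support, ∑ k ∈ ξ.support, (if g * j = g' * k then (1 : ℂ) else 0) •
          (star (v j) * v k) := by
        refine Finset.sum_congr rfl fun g _ => Finset.sum_congr rfl fun g' _ => ?_
        rw [sum_ite_smul_translate π hπ ξ, mul_smul]
    _ = ∑ j ∈ ξ.support, ∑ k ∈ ξ.support,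
        ⟪T (pointMass j), T (pointMass k)⟫_ℂ • (star (v j) * v k) := by
        simp only [hinner, Finset.sum_smul, Finset.smul_sum, mul_smul]
        simp only [Finset.sum_comm (s := c.support) (t := ξ.support)]
    _ = _ := by
        rw [← Finset.sum_coe_sort]
        refine Finset.sum_congr rfl fun j _ => ?_
        rw [← Finset.sum_coe_sort]
        rfl

/-- Over an amenable group, every unitary representation in a C*-algebra is weakly contained in the
regular representation. -/
theorem IsAmenableGroup.norm_sum_le (hamen : IsAmenableGroup Γ) {A : Type*} [CStarAlgebra A]
    (π : Γ →* A) (hπ : ∀ g, star (π g) = π g⁻¹) (c : Γ →₀ ℂ) :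
    ‖∑ g ∈ c.support, c g • π g‖ ≤ ‖∑ g ∈ c.support, c g • leftRegular Γ g‖ := by
  let _ : PartialOrder A := CStarAlgebra.spectralOrder A
  have _ : StarOrderedRing A := CStarAlgebra.spectralOrderedRing A
  set T := ∑ g ∈ c.support, c g • leftRegular Γ g
  set a := ∑ g ∈ c.support, c g • π g with ha
  let C : Set (Γ → ℝ) := {p | ∑ g ∈ c.support, ∑ g' ∈ c.support,
    (star (c g) * c g' * (p (g'⁻¹ * g) : ℂ)) • π (g⁻¹ * g') ≤ ((‖T‖ ^ 2 : ℝ) : ℂ) • (1 : A)}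
  have hC : IsClosed C := isClosed_le (by fun_prop) continuous_const
  have h1 : (fun _ => 1) ∈ C := closure_minimal (by
    rintro _ ⟨ξ, hξ, rfl⟩
    exact sum_regularCoefficient_smul_le π hπ c ξ hξ) hC hamen.one_mem_closure_regularCoefficient
  have h2 : star a * a ≤ algebraMap ℝ A (‖T‖ ^ 2) := by
    have e : star a * a = ∑ g ∈ c.support, ∑ g' ∈ c.support,
        (star (c g) * c g' * ((1 : ℝ) : ℂ)) • π (g⁻¹ * g') := by
      rw [ha, star_sum, Finset.sum_mul_sum]
      refine Finset.sum_congr rfl fun g _ => Finset.sum_congr rfl fun g' _ => ?_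
      rw [star_smul, smul_mul_smul_comm, hπ, ← map_mul, Complex.ofReal_one, mul_one]
    rw [e, Algebra.algebraMap_eq_smul_one, ← Complex.coe_smul]
    exact h1
  rw [← CStarAlgebra.norm_le_iff_le_algebraMap _ (sq_nonneg _) (star_mul_self_nonneg a),
    CStarRing.norm_star_mul_self, ← sq] at h2
  exact (sq_le_sq₀ (norm_nonneg _) (norm_nonneg _)).1 h2

end RegularNorm

/-! ### Closed ideals of C*-algebras -/

section ClosedIdeals

variable {A : Type*} [CStarAlgebra A]

theorem TwoSidedIdeal.complex_smul_mem (I : TwoSidedIdeal A) (c : ℂ) {a : A} (ha : a ∈ I) :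
    c • a ∈ I := by
  rw [← one_mul a, ← smul_mul_assoc]
  exact I.mul_mem_left _ _ ha

/-- Closed ideals of a C*-algebra are self-adjoint: `a*` is the limit of `a* b (b + δ)⁻¹` as
`δ → 0`, where `b = a a*` lies in the ideal. -/
theorem TwoSidedIdeal.star_mem_of_isClosed (I : TwoSidedIdeal A) (hI : IsClosed (I : Set A))
    {a : A} (ha : a ∈ I) : star a ∈ I := by
  let _ : PartialOrder A := CStarAlgebra.spectralOrder A
  have _ : StarOrderedRing A := CStarAlgebra.spectralOrderedRing A
  have hb0 : 0 ≤ a * star a := mul_star_self_nonneg a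
  set b := a * star a with hb
  have hsa : IsSelfAdjoint b := hb0.isSelfAdjoint
  have hspec : ∀ t ∈ spectrum ℝ b, 0 ≤ t := fun t ht => spectrum_nonneg_of_nonneg hb0 ht
  refine hI.closure_subset (Metric.mem_closure_iff.2 fun ε hε => ?_)
  obtain ⟨δ, hδ, hδε⟩ : ∃ δ : ℝ, 0 < δ ∧ δ < ε ^ 2 := exists_between (by positivity)
  have hne : ∀ t ∈ spectrum ℝ b, t + δ ≠ 0 := fun t ht => by have := hspec t ht; positivity
  have hc1 : ContinuousOn (fun t : ℝ => (t + δ)⁻¹) (spectrum ℝ b) :=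
    (by fun_prop : ContinuousOn (fun t : ℝ => t + δ) _).inv₀ hne
  have hc2 : ContinuousOn (fun t : ℝ => δ * (t + δ)⁻¹) (spectrum ℝ b) := hc1.const_smul δ
  set v := cfc (fun t : ℝ => (t + δ)⁻¹) b
  set w := cfc (fun t : ℝ => δ * (t + δ)⁻¹) b with hw
  have hbv : b * v + w = 1 := by
    have hc3 : ContinuousOn (fun t : ℝ => t * (t + δ)⁻¹) (spectrum ℝ b) := continuousOn_id.mul hc1
    have h1 : b * v = cfc (fun t : ℝ => t * (t + δ)⁻¹) b := by
      rw [cfc_mul (fun t : ℝ => t) (fun t => (t + δ)⁻¹) b continuousOn_id hc1, cfc_id' ℝ b]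
    rw [h1, hw, ← cfc_add (a := b) _ _ hc3 hc2, ← cfc_one ℝ b]
    refine cfc_congr fun t ht => ?_
    have := hne t ht
    simp only [Pi.one_apply]
    field_simp
  refine ⟨star a * (b * v), I.mul_mem_left _ _ (I.mul_mem_right _ _ (I.mul_mem_right _ _ ha)), ?_⟩
  have hdiff : star a - star a * (b * v) = star a * w := by
    rw [eq_sub_iff_add_eq'.2 hbv, mul_sub, mul_one]
  have hwb : w * b * w = cfc (fun t : ℝ => δ * (t + δ)⁻¹ * t * (δ * (t + δ)⁻¹)) b := by
    have hc3 : ContinuousOn (fun t : ℝ => δ * (t + δ)⁻¹ * t) (spectrum ℝ b) :=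
      hc2.mul continuousOn_id
    rw [cfc_mul (fun t => δ * (t + δ)⁻¹ * t) (fun t => δ * (t + δ)⁻¹) b hc3 hc2,
      cfc_mul (fun t => δ * (t + δ)⁻¹) (fun t => t) b hc2 continuousOn_id, cfc_id' ℝ b]
  -- `‖a* w‖² = ‖w b w‖`, and `t (δ / (t + δ))² ≤ δ` on the spectrum of `b`
  have hsq : ‖star a * w‖ ^ 2 ≤ δ := by
    have hwsa : star w = w := (cfc_predicate (R := ℝ) _ b : IsSelfAdjoint w)
    rw [sq, ← CStarRing.norm_star_mul_self, star_mul, star_star, hwsa, mul_assoc,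
      ← mul_assoc a, ← hb, ← mul_assoc, hwb]
    refine norm_cfc_le hδ.le fun t ht => ?_
    have h0 := hspec t ht
    have hpos : 0 < t + δ := by positivity
    rw [Real.norm_of_nonneg (by positivity)]
    have e : δ * (t + δ)⁻¹ * t * (δ * (t + δ)⁻¹) = δ * ((δ * t) / (t + δ) ^ 2) := by
      field_simp
    rw [e]
    refine mul_le_of_le_one_right hδ.le ((div_le_one (by positivity)).2 ?_)
    nlinarith
  rw [dist_eq_norm, hdiff]
  exact lt_of_pow_lt_pow_left₀ 2 hε.le (hsq.trans_lt hδε)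

/-- The star-subalgebra `ℂ1 + I` for a two-sided ideal `I`. Closedness of `I` makes it
self-adjoint. -/
def idealAddScalars (I : TwoSidedIdeal A) (hI : IsClosed (I : Set A)) : StarSubalgebra ℂ A where
  carrier := {a | ∃ c : ℂ, a - algebraMap ℂ A c ∈ I}
  mul_mem' := by
    rintro a b ⟨c, hc⟩ ⟨d, hd⟩
    refine ⟨c * d, ?_⟩
    have : a * b - algebraMap ℂ A (c * d) =
        (a - algebraMap ℂ A c) * b + algebraMap ℂ A c * (b - algebraMap ℂ A d) := by
      rw [map_mul]; noncomm_ring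
    rw [this]
    exact I.add_mem (I.mul_mem_right _ _ hc) (I.mul_mem_left _ _ hd)
  add_mem' := by
    rintro a b ⟨c, hc⟩ ⟨d, hd⟩
    exact ⟨c + d, by rw [map_add, add_sub_add_comm]; exact I.add_mem hc hd⟩
  algebraMap_mem' c := ⟨c, by rw [sub_self]; exact I.zero_mem⟩
  star_mem' := by
    rintro a ⟨c, hc⟩
    exact ⟨star c, by
      rw [algebraMap_star_comm, ← star_sub]; exact I.star_mem_of_isClosed hI hc⟩

theorem mem_idealAddScalars {I : TwoSidedIdeal A} {hI : IsClosed (I : Set A)} {a : A} :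
    a ∈ idealAddScalars I hI ↔ ∃ c : ℂ, a - algebraMap ℂ A c ∈ I := Iff.rfl

theorem isClosed_idealAddScalars (I : TwoSidedIdeal A) (hI : IsClosed (I : Set A)) :
    IsClosed (idealAddScalars I hI : Set A) := by
  let s : Submodule ℂ A :=
    { carrier := I
      add_mem' := fun ha hb => I.add_mem ha hb
      zero_mem' := I.zero_mem
      smul_mem' := fun c _ ha => I.complex_smul_mem c ha }
  convert! s.isClosed_sup_finiteDimensional (ℂ ∙ (1 : A)) hI
  ext a
  simp only [SetLike.mem_coe, Submodule.mem_sup, Submodule.mem_span_singleton,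
    mem_idealAddScalars]
  constructor
  · rintro ⟨c, hc⟩
    exact ⟨_, hc, _, ⟨c, rfl⟩, by rw [Algebra.algebraMap_eq_smul_one, sub_add_cancel]⟩
  · rintro ⟨y, hy, _, ⟨c, rfl⟩, rfl⟩
    exact ⟨c, by rwa [Algebra.algebraMap_eq_smul_one, add_sub_cancel_right]⟩

theorem mul_mul_mem_idealAddScalars {I : TwoSidedIdeal A} {hI : IsClosed (I : Set A)} {u v x : A}
    (huv : u * v = 1) (hx : x ∈ idealAddScalars I hI) : u * x * v ∈ idealAddScalars I hI := by
  obtain ⟨c, hc⟩ := hx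
  refine ⟨c, ?_⟩
  have : u * x * v - algebraMap ℂ A c = u * (x - algebraMap ℂ A c) * v := by
    rw [mul_sub, sub_mul, ← Algebra.commutes c u, mul_assoc (algebraMap _ _ c), huv, mul_one]
  rw [this]
  exact I.mul_mem_right _ _ (I.mul_mem_left _ _ hc)

theorem TwoSidedIdeal.isClosed_ker {B : Type*} [CStarAlgebra B] (φ : A →⋆ₐ[ℂ] B) :
    IsClosed (TwoSidedIdeal.ker φ : Set A) := by
  have h : (TwoSidedIdeal.ker φ : Set A) = φ ⁻¹' {0} := by
    ext x
    exact TwoSidedIdeal.mem_ker φ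
  rw [h]
  exact isClosed_singleton.preimage (AddMonoidHomClass.continuous_of_bound φ 1 fun a => by
    simpa using NonUnitalStarAlgHom.norm_apply_le φ a)

/-- A proper ideal contains no nonzero scalars. -/
theorem TwoSidedIdeal.eq_zero_of_algebraMap_mem {I : TwoSidedIdeal A} (hI : I ≠ ⊤) {c : ℂ}
    (hc : algebraMap ℂ A c ∈ I) : c = 0 := by
  by_contra h
  refine hI ((TwoSidedIdeal.one_mem_iff I).1 ?_)
  have := I.complex_smul_mem c⁻¹ hc
  rwa [Algebra.algebraMap_eq_smul_one, smul_smul, inv_mul_cancel₀ h, one_smul] at this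

/-- If `I` has codimension one, a proper ideal containing `I` equals `I`. -/
theorem TwoSidedIdeal.eq_of_le_of_forall_exists {I J : TwoSidedIdeal A} (hIJ : I ≤ J) (hJ : J ≠ ⊤)
    (hI : ∀ a, ∃ c : ℂ, a - algebraMap ℂ A c ∈ I) : I = J := by
  refine le_antisymm hIJ fun a ha => ?_
  obtain ⟨c, hc⟩ := hI a
  have h2 := J.sub_mem ha (hIJ hc)
  rw [sub_sub_cancel] at h2
  rwa [TwoSidedIdeal.eq_zero_of_algebraMap_mem hJ h2, map_zero, sub_zero] at hc

end ClosedIdeals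

/-! ### The universal property of the reduced C*-algebra -/

section UniversalProperty

open scoped InnerProductSpace

variable {Γ : Type u} [Group Γ]

theorem star_leftRegular (g : Γ) : star (leftRegular Γ g) = leftRegular Γ g⁻¹ := by
  rw [ContinuousLinearMap.star_eq_adjoint, eq_comm, ContinuousLinearMap.eq_adjoint_iff]
  intro ξ η
  have h : leftRegular Γ g (leftRegular Γ g⁻¹ ξ) = ξ := by
    ext k
    simp [leftRegular_apply]
  calc _ = ⟪leftTranslation g (leftRegular Γ g⁻¹ ξ), leftTranslation g η⟫_ℂ :=
        ((leftTranslation g).inner_map_map _ _).symm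
    _ = ⟪leftRegular Γ g (leftRegular Γ g⁻¹ ξ), leftRegular Γ g η⟫_ℂ := rfl
    _ = _ := by rw [h]

instance isClosed_reducedCStar :
    IsClosed (reducedCStar Γ : Set (ℓ²(Γ, ℂ) →L[ℂ] ℓ²(Γ, ℂ))) :=
  StarSubalgebra.isClosed_topologicalClosure _

instance cstarAlgebraReducedCStar : CStarAlgebra (reducedCStar Γ) :=
  StarSubalgebra.cstarAlgebra _

/-- The unitary representation `g ↦ λ(g)` of `Γ` in `C*_r(Γ)`. -/
def reducedUnitaryHom (Γ : Type u) [Group Γ] : Γ →* reducedCStar Γ where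
  toFun := reducedUnitary
  map_one' := Subtype.ext (map_one (leftRegular Γ))
  map_mul' g h := Subtype.ext (map_mul (leftRegular Γ) g h)

theorem star_reducedUnitary (g : Γ) : star (reducedUnitary g) = reducedUnitary g⁻¹ :=
  Subtype.ext (star_leftRegular g)

/-- The left regular representation `ℂΓ → C*_r(Γ)` of the group ring. -/
def regularHom (Γ : Type u) [Group Γ] : MonoidAlgebra ℂ Γ →ₐ[ℂ] reducedCStar Γ :=
  MonoidAlgebra.lift ℂ (reducedCStar Γ) Γ (reducedUnitaryHom Γ)

theorem regularHom_single (g : Γ) (c : ℂ) :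
    regularHom Γ (MonoidAlgebra.single g c) = c • reducedUnitary g :=
  MonoidAlgebra.lift_single _ _ _

theorem coe_regularHom (x : MonoidAlgebra ℂ Γ) :
    (regularHom Γ x : ℓ²(Γ, ℂ) →L[ℂ] ℓ²(Γ, ℂ)) =
      ∑ g ∈ x.coeff.support, x.coeff g • leftRegular Γ g := by
  rw [regularHom, MonoidAlgebra.lift_apply, Finsupp.sum, AddSubmonoidClass.coe_finsetSum]
  rfl

theorem groupRingStar_single (g : Γ) (c : ℂ) :
    groupRingStar (MonoidAlgebra.single g c) = MonoidAlgebra.single g⁻¹ (star c) := by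
  simp [groupRingStar, MonoidAlgebra.coeff_single]

/-- A homomorphism on the group ring that sends group elements to unitaries preserves the
involution. -/
theorem map_groupRingStar {A : Type*} [CStarAlgebra A] (ι : MonoidAlgebra ℂ Γ →ₐ[ℂ] A)
    (hι : ∀ g, star (ι (MonoidAlgebra.single g 1)) = ι (MonoidAlgebra.single g⁻¹ 1))
    (x : MonoidAlgebra ℂ Γ) : ι (groupRingStar x) = star (ι x) := by
  have hs : ∀ (g : Γ) (c : ℂ), MonoidAlgebra.single g c = c • MonoidAlgebra.single g 1 :=
    fun g c => by simp
  rw [MonoidAlgebra.lift_unique ι x, groupRingStar, Finsupp.sum, Finsupp.sum, map_sum, star_sum]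
  refine Finset.sum_congr rfl fun g _ => ?_
  rw [hs, map_smul, star_smul, hι]

theorem regularHom_groupRingStar (x : MonoidAlgebra ℂ Γ) :
    regularHom Γ (groupRingStar x) = star (regularHom Γ x) := by
  refine map_groupRingStar _ (fun g => ?_) x
  rw [regularHom_single, regularHom_single, one_smul, one_smul, star_reducedUnitary]

theorem regularHom_injective : Function.Injective (regularHom Γ) := by
  classical
  rw [injective_iff_map_eq_zero]
  intro x hx
  ext k
  have h := congrArg (fun T : reducedCStar Γ =>
    (T : ℓ²(Γ, ℂ) →L[ℂ] ℓ²(Γ, ℂ)) (pointMass 1) k) hx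
  simp only [coe_regularHom, sum_apply, smul_apply, leftRegular_pointMass, mul_one] at h
  rw [← lp.evalₗ_apply (𝕜 := ℂ), map_sum] at h
  simpa [pointMass_apply, Finset.sum_ite_eq] using h

theorem denseRange_regularHom : DenseRange (regularHom Γ) := by
  rintro ⟨T, hT⟩
  rw [closure_subtype]
  refine closure_mono ?_ hT
  intro S hS
  suffices ∃ x, (regularHom Γ x : ℓ²(Γ, ℂ) →L[ℂ] ℓ²(Γ, ℂ)) = S by
    obtain ⟨x, rfl⟩ := this
    exact ⟨_, ⟨x, rfl⟩, rfl⟩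
  induction hS using StarAlgebra.adjoin_induction with
  | mem S h =>
    obtain ⟨g, rfl⟩ := h
    exact ⟨MonoidAlgebra.single g 1, by rw [regularHom_single, one_smul]; rfl⟩
  | algebraMap c => exact ⟨algebraMap ℂ _ c, by rw [AlgHom.commutes]; rfl⟩
  | add S T _ _ hS hT =>
    obtain ⟨x, rfl⟩ := hS
    obtain ⟨y, rfl⟩ := hT
    exact ⟨x + y, by rw [map_add]; rfl⟩
  | mul S T _ _ hS hT =>
    obtain ⟨x, rfl⟩ := hS
    obtain ⟨y, rfl⟩ := hT
    exact ⟨x * y, by rw [map_mul]; rfl⟩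
  | star S _ hS =>
    obtain ⟨x, rfl⟩ := hS
    exact ⟨groupRingStar x, by rw [regularHom_groupRingStar]; rfl⟩

/-- Over an amenable group, a star-representation of the group ring in a C*-algebra extends to
`C*_r(Γ)`, because its norm is dominated by the reduced norm. -/
theorem IsAmenableGroup.exists_starAlgHom (hamen : IsAmenableGroup Γ) {A : Type*} [CStarAlgebra A]
    (ι : MonoidAlgebra ℂ Γ →ₐ[ℂ] A) (hι : ∀ x, ι (groupRingStar x) = star (ι x)) :
    ∃ ρ : reducedCStar Γ →⋆ₐ[ℂ] A, ∀ x, ρ (regularHom Γ x) = ι x := by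
  let π : Γ →* A := (MonoidAlgebra.lift ℂ A Γ).symm ι
  have hπ : ∀ g, star (π g) = π g⁻¹ := fun g => by
    change star (ι (MonoidAlgebra.single g 1)) = ι (MonoidAlgebra.single g⁻¹ 1)
    rw [← hι, groupRingStar_single, star_one]
  have hnorm : ∀ x, ‖ι.toLinearMap x‖ ≤ 1 * ‖(regularHom Γ).toLinearMap x‖ := fun x => by
    have h := hamen.norm_sum_le π hπ x.coeff
    rw [← coe_regularHom] at h
    rw [one_mul]
    refine le_of_eq_of_le ?_ h
    rw [AlgHom.toLinearMap_apply, MonoidAlgebra.lift_unique ι x]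
    rfl
  have hd : DenseRange (regularHom Γ).toLinearMap := denseRange_regularHom
  let φ : reducedCStar Γ →L[ℂ] A := ι.toLinearMap.extendOfNorm (regularHom Γ).toLinearMap
  have hφ : ∀ x, φ (regularHom Γ x) = ι x :=
    ι.toLinearMap.extendOfNorm_eq hd ⟨1, hnorm⟩
  have hone : φ 1 = 1 := by rw [← map_one (regularHom Γ), hφ, map_one]
  refine ⟨
    { toFun := φ
      map_one' := hone
      map_mul' := fun a b => ?_
      map_zero' := map_zero φ
      map_add' := map_add φ
      commutes' := fun c => ?_
      map_star' := fun a => ?_ }, hφ⟩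
  · refine denseRange_regularHom.induction_on₂ (p := fun a b => φ (a * b) = φ a * φ b)
      (isClosed_eq (by fun_prop) (by fun_prop)) (fun x y => ?_) a b
    rw [← map_mul, hφ, hφ, hφ, map_mul]
  · change φ (algebraMap ℂ _ c) = _
    rw [Algebra.algebraMap_eq_smul_one, map_smul, hone, Algebra.algebraMap_eq_smul_one]
  · refine denseRange_regularHom.induction_on (p := fun a => φ (star a) = star (φ a)) a
      (isClosed_eq (by fun_prop) (by fun_prop)) fun x => ?_
    rw [← regularHom_groupRingStar, hφ, hφ, hι]

end UniversalProperty

/-! ### Ideals of the reduced C*-algebra under the C*-ISR property -/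

section ReducedIdeals

variable {Γ : Type u} [Group Γ]

/-- The operators in `C*_r(N)` leave `ℓ²(N)` invariant. -/
theorem apply_eq_zero_of_mem_reducedCStarOfSubgroup {N : Subgroup Γ}
    {T : ℓ²(Γ, ℂ) →L[ℂ] ℓ²(Γ, ℂ)} (hT : T ∈ reducedCStarOfSubgroup N) {ξ : ℓ²(Γ, ℂ)}
    (hξ : ∀ k ∉ N, ξ k = 0) {k : Γ} (hk : k ∉ N) : T ξ k = 0 := by
  let Q : (ℓ²(Γ, ℂ) →L[ℂ] ℓ²(Γ, ℂ)) → Prop := fun T =>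
    ∀ ξ : ℓ²(Γ, ℂ), (∀ k ∉ N, ξ k = 0) → ∀ k ∉ N, T ξ k = 0
  have hreg : ∀ g ∈ N, Q (leftRegular Γ g) := fun g hg ξ hξ k hk => by
    rw [leftRegular_apply]
    exact hξ _ fun h => hk (by simpa using N.mul_mem hg h)
  -- invariance of `ℓ²(N)` need not pass to adjoints, so it is carried for `T` and `T*` together
  have hadj : ∀ T ∈ StarAlgebra.adjoin ℂ (leftRegular Γ '' (N : Set Γ)), Q T ∧ Q (star T) := by
    intro T hT
    induction hT using StarAlgebra.adjoin_induction with
    | mem T h =>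
      obtain ⟨g, hg, rfl⟩ := h
      rw [star_leftRegular]
      exact ⟨hreg g hg, hreg _ (N.inv_mem hg)⟩
    | algebraMap c =>
      have hs : ∀ c : ℂ, Q (algebraMap ℂ _ c) := fun c ξ hξ k hk => by
        change c * ξ k = 0
        rw [hξ k hk, mul_zero]
      rw [← algebraMap_star_comm]
      exact ⟨hs c, hs _⟩
    | add S T _ _ hS hT =>
      have hs : ∀ S T, Q S → Q T → Q (S + T) := fun S T hS hT ξ hξ k hk => by
        change S ξ k + T ξ k = 0
        rw [hS ξ hξ k hk, hT ξ hξ k hk, add_zero]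
      rw [star_add]
      exact ⟨hs _ _ hS.1 hT.1, hs _ _ hS.2 hT.2⟩
    | mul S T _ _ hS hT =>
      have hs : ∀ S T, Q S → Q T → Q (S * T) := fun S T hS hT ξ hξ k hk => hS _ (hT ξ hξ) k hk
      rw [star_mul]
      exact ⟨hs _ _ hS.1 hT.1, hs _ _ hT.2 hS.2⟩
    | star S _ hS =>
      rw [star_star]
      exact hS.symm
  have hclosed : IsClosed {S : ℓ²(Γ, ℂ) →L[ℂ] ℓ²(Γ, ℂ) | S ξ k = 0} := by
    have : Continuous fun S : ℓ²(Γ, ℂ) →L[ℂ] ℓ²(Γ, ℂ) =>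
        lp.evalCLM ℂ (fun _ : Γ => ℂ) 2 k (S ξ) := by fun_prop
    exact isClosed_eq this continuous_const
  exact closure_minimal (fun S hS => (hadj S hS).1 ξ hξ k hk) hclosed hT

/-- `C*_r({e})` consists of the scalars. -/
theorem mem_reducedCStarOfSubgroup_bot {T : ℓ²(Γ, ℂ) →L[ℂ] ℓ²(Γ, ℂ)}
    (hT : T ∈ reducedCStarOfSubgroup (⊥ : Subgroup Γ)) : ∃ c : ℂ, T = algebraMap ℂ _ c := by
  have hle : StarAlgebra.adjoin ℂ (leftRegular Γ '' ((⊥ : Subgroup Γ) : Set Γ)) ≤ ⊥ := by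
    rw [StarAlgebra.adjoin_le_iff]
    rintro _ ⟨g, hg, rfl⟩
    rw [Subgroup.mem_bot.1 hg, map_one]
    exact one_mem _
  have hfin : IsClosed
      ((⊥ : StarSubalgebra ℂ (ℓ²(Γ, ℂ) →L[ℂ] ℓ²(Γ, ℂ))) : Set (ℓ²(Γ, ℂ) →L[ℂ] ℓ²(Γ, ℂ))) := by
    convert! Submodule.closed_of_finiteDimensional (ℂ ∙ (1 : ℓ²(Γ, ℂ) →L[ℂ] ℓ²(Γ, ℂ)))
    ext T
    simp only [SetLike.mem_coe, StarSubalgebra.mem_bot, Submodule.mem_span_singleton, Set.mem_range,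
      Algebra.algebraMap_eq_smul_one]
  obtain ⟨c, rfl⟩ :=
    StarSubalgebra.mem_bot.1 (StarSubalgebra.topologicalClosure_minimal hle hfin hT)
  exact ⟨c, rfl⟩

/-- The C*-ISR property, applied to the star-subalgebra `ℂ1 + I`. -/
theorem HasCStarISR.exists_subgroup_mem_iff (hISR : HasCStarISR Γ)
    {I : TwoSidedIdeal (reducedCStar Γ)} (hI : IsClosed (I : Set (reducedCStar Γ))) :
    ∃ N : Subgroup Γ, ∀ x : reducedCStar Γ,
      x ∈ idealAddScalars I hI ↔ (x : ℓ²(Γ, ℂ) →L[ℂ] ℓ²(Γ, ℂ)) ∈ reducedCStarOfSubgroup N := by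
  let B := (idealAddScalars I hI).map (reducedCStar Γ).subtype
  have hB : ∀ x : reducedCStar Γ, (x : ℓ²(Γ, ℂ) →L[ℂ] ℓ²(Γ, ℂ)) ∈ B ↔ x ∈ idealAddScalars I hI :=
    fun x => ⟨fun ⟨y, hy, hyx⟩ => Subtype.ext hyx ▸ hy, fun hx => ⟨x, hx, rfl⟩⟩
  have hinv : ∀ (g : Γ), ∀ a ∈ B, leftRegular Γ g * a * leftRegular Γ g⁻¹ ∈ B := by
    rintro g _ ⟨x, hx, rfl⟩
    have h1 : reducedUnitaryHom Γ g * reducedUnitaryHom Γ g⁻¹ = 1 := by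
      rw [← map_mul, mul_inv_cancel, map_one]
    exact (hB (reducedUnitaryHom Γ g * x * reducedUnitaryHom Γ g⁻¹)).2
      (mul_mul_mem_idealAddScalars h1 hx)
  obtain ⟨N, -, hN⟩ := hISR B
    (isClosed_reducedCStar.isClosedEmbedding_subtypeVal.isClosedMap _
      (isClosed_idealAddScalars I hI))
    (by rintro _ ⟨x, -, rfl⟩; exact x.2) hinv
  exact ⟨N, fun x => by rw [← hN, hB]⟩

theorem mem_idealAddScalars_of_mem {A : Type*} [CStarAlgebra A] {I : TwoSidedIdeal A}
    {hI : IsClosed (I : Set A)} {x : A} (hx : x ∈ I) : x ∈ idealAddScalars I hI :=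
  ⟨0, by rwa [map_zero, sub_zero]⟩

/-- If `ℂ1 + I = C*_r({e})`, then `I` consists of scalars, so it is zero or everything. -/
theorem exists_mem_ne_one_of_idealAddScalars {I : TwoSidedIdeal (reducedCStar Γ)}
    {hI : IsClosed (I : Set (reducedCStar Γ))} (hbot : I ≠ ⊥) (htop : I ≠ ⊤) {N : Subgroup Γ}
    (hN : ∀ x : reducedCStar Γ,
      x ∈ idealAddScalars I hI ↔ (x : ℓ²(Γ, ℂ) →L[ℂ] ℓ²(Γ, ℂ)) ∈ reducedCStarOfSubgroup N) :
    ∃ n ∈ N, n ≠ 1 := by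
  by_contra! h
  rw [(Subgroup.eq_bot_iff_forall N).2 h] at hN
  refine hbot (le_bot_iff.1 fun x hx => ?_)
  obtain ⟨c, hc⟩ := mem_reducedCStarOfSubgroup_bot ((hN x).1 (mem_idealAddScalars_of_mem hx))
  have hxc : x = algebraMap ℂ (reducedCStar Γ) c := Subtype.ext hc
  have hc0 : c = 0 := TwoSidedIdeal.eq_zero_of_algebraMap_mem htop (by rw [← hxc]; exact hx)
  rw [TwoSidedIdeal.mem_bot, hxc, hc0, map_zero]

/-- If `λ(n) - c` lies in `I` for some `n ≠ e` in `N`, then so do the translates `λ(gn) - c λ(g)`;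
these belong to `C*_r(N)` only for `g ∈ N`. -/
theorem eq_top_of_idealAddScalars {I : TwoSidedIdeal (reducedCStar Γ)}
    {hI : IsClosed (I : Set (reducedCStar Γ))} {N : Subgroup Γ}
    (hN : ∀ x : reducedCStar Γ,
      x ∈ idealAddScalars I hI ↔ (x : ℓ²(Γ, ℂ) →L[ℂ] ℓ²(Γ, ℂ)) ∈ reducedCStarOfSubgroup N)
    {n : Γ} (hn : n ∈ N) (hn1 : n ≠ 1) : N = ⊤ := by
  obtain ⟨c, hc⟩ : reducedUnitary n ∈ idealAddScalars I hI := (hN _).2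
    (StarSubalgebra.le_topologicalClosure _ (StarAlgebra.subset_adjoin ℂ _ ⟨n, hn, rfl⟩))
  rw [Subgroup.eq_top_iff']
  intro g
  by_contra hg
  have hmem := (hN _).1 (mem_idealAddScalars_of_mem (I.mul_mem_left (reducedUnitary g) _ hc))
  have hgn : g * n ∉ N := fun h => hg ((N.mul_mem_cancel_right hn).1 h)
  have h0 := apply_eq_zero_of_mem_reducedCStarOfSubgroup hmem (ξ := pointMass 1)
    (fun k hk => by
      rw [pointMass_apply, if_neg]
      rintro rfl
      exact hk N.one_mem) hgn
  have h1 : leftRegular Γ g (leftRegular Γ n (pointMass 1) - c • pointMass 1) =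
      pointMass (g * n) - c • pointMass g := by
    rw [map_sub, map_smul, leftRegular_pointMass, leftRegular_pointMass, leftRegular_pointMass,
      mul_one, mul_one]
  change leftRegular Γ g (leftRegular Γ n (pointMass 1) - c • pointMass 1) (g * n) = 0 at h0
  rw [h1] at h0
  change pointMass (g * n) (g * n) - c * pointMass g (g * n) = 0 at h0
  simp [pointMass_apply, hn1] at h0

/-- Under the C*-ISR property, proper nonzero closed ideals have codimension one. -/
theorem HasCStarISR.exists_sub_algebraMap_mem (hISR : HasCStarISR Γ)
    {I : TwoSidedIdeal (reducedCStar Γ)} (hI : IsClosed (I : Set (reducedCStar Γ)))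
    (hbot : I ≠ ⊥) (htop : I ≠ ⊤) (a : reducedCStar Γ) :
    ∃ c : ℂ, a - algebraMap ℂ (reducedCStar Γ) c ∈ I := by
  obtain ⟨N, hN⟩ := hISR.exists_subgroup_mem_iff hI
  obtain ⟨n, hn, hn1⟩ := exists_mem_ne_one_of_idealAddScalars hbot htop hN
  refine (hN a).2 ?_
  rw [eq_top_of_idealAddScalars hN hn hn1, reducedCStarOfSubgroup, Subgroup.coe_top,
    Set.image_univ]
  exact a.2

/-! ### The augmentation ideal and the unique completion -/

theorem reducedUnitary_sub_mem_augmentationIdeal (g : Γ) :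
    reducedUnitary g - reducedUnitary 1 ∈ augmentationIdeal Γ :=
  (TwoSidedIdeal.mem_sInf _).2 fun _ hI => hI.2 g

theorem isClosed_augmentationIdeal :
    IsClosed (augmentationIdeal Γ : Set (reducedCStar Γ)) := by
  have : (augmentationIdeal Γ : Set (reducedCStar Γ)) =
      ⋂ I ∈ {I : TwoSidedIdeal (reducedCStar Γ) | IsClosed (I : Set (reducedCStar Γ)) ∧
        ∀ g : Γ, reducedUnitary g - reducedUnitary 1 ∈ I}, (I : Set (reducedCStar Γ)) := by
    ext x
    simp only [Set.mem_iInter, SetLike.mem_coe]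
    exact TwoSidedIdeal.mem_sInf _
  rw [this]
  exact isClosed_biInter fun I hI => hI.1

theorem reducedUnitary_one : (reducedUnitary 1 : reducedCStar Γ) = 1 :=
  map_one (reducedUnitaryHom Γ)

/-- The augmentation ideal has codimension at most one, since every `λ(g)` is congruent to `1`. -/
theorem exists_sub_algebraMap_mem_augmentationIdeal (a : reducedCStar Γ) :
    ∃ c : ℂ, a - algebraMap ℂ (reducedCStar Γ) c ∈ augmentationIdeal Γ := by
  refine closure_minimal (s := Set.range (regularHom Γ)) ?_
    (isClosed_idealAddScalars _ isClosed_augmentationIdeal) (denseRange_regularHom a)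
  rintro _ ⟨x, rfl⟩
  rw [MonoidAlgebra.lift_unique (regularHom Γ) x]
  refine sum_mem fun g _ => SMulMemClass.smul_mem _ ⟨1, ?_⟩
  rw [regularHom_single, one_smul, map_one, ← reducedUnitary_one]
  exact reducedUnitary_sub_mem_augmentationIdeal g

/-- The trivial representation of an amenable group factors through `C*_r(Γ)`, and its kernel is the
augmentation ideal. -/
theorem IsAmenableGroup.exists_trivial_character (hamen : IsAmenableGroup Γ) :
    ∃ ε : reducedCStar Γ →⋆ₐ[ℂ] ℂ, (∀ g : Γ, ε (reducedUnitary g) = 1) ∧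
      ∀ a : reducedCStar Γ, a ∈ augmentationIdeal Γ ↔ ε a = 0 := by
  obtain ⟨ε, hε⟩ := hamen.exists_starAlgHom (MonoidAlgebra.lift ℂ ℂ Γ (1 : Γ →* ℂ))
    (map_groupRingStar _ fun g => by simp)
  have hε1 : ∀ g : Γ, ε (reducedUnitary g) = 1 := fun g => by
    have := hε (MonoidAlgebra.single g 1)
    rw [regularHom_single, one_smul] at this
    simpa using this
  have hle : ∀ a ∈ augmentationIdeal Γ, ε a = 0 := fun a ha => by
    refine (TwoSidedIdeal.mem_ker ε).1
      ((TwoSidedIdeal.mem_sInf _).1 ha (TwoSidedIdeal.ker ε) ⟨?_, fun g => ?_⟩)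
    · exact TwoSidedIdeal.isClosed_ker ε
    · rw [TwoSidedIdeal.mem_ker, map_sub, hε1, hε1, sub_self]
  refine ⟨ε, hε1, fun a => ⟨hle a, fun ha => ?_⟩⟩
  obtain ⟨c, hc⟩ := exists_sub_algebraMap_mem_augmentationIdeal a
  have h := hle _ hc
  rw [map_sub, ha, AlgHomClass.commutes, zero_sub, neg_eq_zero] at h
  have hc0 : c = 0 := h
  rwa [hc0, map_zero, sub_zero] at hc

theorem augmentationIdeal_ne_top (hamen : IsAmenableGroup Γ) : augmentationIdeal Γ ≠ ⊤ := by
  obtain ⟨ε, -, hε⟩ := hamen.exists_trivial_character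
  intro h
  have : (1 : reducedCStar Γ) ∈ augmentationIdeal Γ := h ▸ TwoSidedIdeal.mem_top _
  rw [hε, map_one] at this
  exact one_ne_zero this

/-- For `g` distinct from `e` and `h`, the element `λ(g) - 1` is not a multiple of `λ(h) - 1`. -/
theorem eq_zero_of_smul_sub_smul_eq_zero {g h : Γ} (hg : g ≠ 1) (hgh : g ≠ h) {c d : ℂ}
    (H : d • (reducedUnitary g - reducedUnitary 1) - c • (reducedUnitary h - reducedUnitary 1) =
      (0 : reducedCStar Γ)) : d = 0 := by
  let x (k : Γ) : MonoidAlgebra ℂ Γ := MonoidAlgebra.single k 1 - MonoidAlgebra.single 1 1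
  have hx : ∀ k, regularHom Γ (x k) = reducedUnitary k - reducedUnitary 1 := fun k => by
    rw [map_sub, regularHom_single, regularHom_single, one_smul, one_smul]
  have h1 : d • x g - c • x h = 0 := regularHom_injective (by
    rw [map_sub, map_smul, map_smul, hx, hx, H, map_zero])
  have h2 := congrArg (fun x : MonoidAlgebra ℂ Γ => x.coeff g) h1
  simpa [x, MonoidAlgebra.coeff_single, Finsupp.single_apply, hg.symm, hgh.symm] using h2

/-- Two closed ideals of codimension one in `C*_r(Γ)` meet nontrivially, for dimension reasons. -/
theorem inf_augmentationIdeal_ne_bot [Infinite Γ] {I : TwoSidedIdeal (reducedCStar Γ)}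
    (hI : ∀ a, ∃ c : ℂ, a - algebraMap ℂ (reducedCStar Γ) c ∈ I) :
    I ⊓ augmentationIdeal Γ ≠ ⊥ := by
  classical
  intro hbot
  obtain ⟨g, hg⟩ := exists_ne (1 : Γ)
  obtain ⟨h, hh⟩ := Infinite.exists_notMem_finset (insert g {1} : Finset Γ)
  simp only [Finset.mem_insert, Finset.mem_singleton, not_or] at hh
  let y (k : Γ) : reducedCStar Γ := reducedUnitary k - reducedUnitary 1
  have hy : ∀ k, y k ∈ augmentationIdeal Γ := reducedUnitary_sub_mem_augmentationIdeal
  obtain ⟨c, hc⟩ := hI (y g)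
  obtain ⟨d, hd⟩ := hI (y h)
  have hI0 : d • y g - c • y h = 0 := by
    rw [← TwoSidedIdeal.mem_bot, ← hbot, TwoSidedIdeal.mem_inf]
    refine ⟨?_, (augmentationIdeal Γ).sub_mem (TwoSidedIdeal.complex_smul_mem _ _ (hy g))
      (TwoSidedIdeal.complex_smul_mem _ _ (hy h))⟩
    -- modulo `I`, the two elements are the scalars `c` and `d`
    have e : d • y g - c • y h = d • (y g - algebraMap ℂ _ c) - c • (y h - algebraMap ℂ _ d) := by
      simp only [smul_sub, Algebra.algebraMap_eq_smul_one, smul_smul, mul_comm d c]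
      abel
    rw [e]
    exact I.sub_mem (TwoSidedIdeal.complex_smul_mem _ _ hc)
      (TwoSidedIdeal.complex_smul_mem _ _ hd)
  have hd0 : d = 0 := eq_zero_of_smul_sub_smul_eq_zero hg (Ne.symm hh.1) hI0
  rw [hd0, map_zero, sub_zero] at hd
  have hyh : y h = 0 := by
    rw [← TwoSidedIdeal.mem_bot, ← hbot, TwoSidedIdeal.mem_inf]
    exact ⟨hd, hy h⟩
  exact one_ne_zero (eq_zero_of_smul_sub_smul_eq_zero (c := 0) (d := 1) hh.2 hh.1 (by
    rw [one_smul, zero_smul, sub_zero]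
    exact hyh))

/-- Under the C*-ISR property, the augmentation ideal is the only nontrivial closed ideal. -/
theorem eq_augmentationIdeal [Infinite Γ] (hamen : IsAmenableGroup Γ) (hISR : HasCStarISR Γ)
    {I : TwoSidedIdeal (reducedCStar Γ)} (hI : IsClosed (I : Set (reducedCStar Γ)))
    (hbot : I ≠ ⊥) (htop : I ≠ ⊤) : I = augmentationIdeal Γ := by
  have hK : IsClosed ((I ⊓ augmentationIdeal Γ : TwoSidedIdeal (reducedCStar Γ)) :
      Set (reducedCStar Γ)) := hI.inter isClosed_augmentationIdeal
  have hcod := hISR.exists_sub_algebraMap_mem hK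
    (inf_augmentationIdeal_ne_bot (hISR.exists_sub_algebraMap_mem hI hbot htop))
    (fun h => htop (top_le_iff.1 (h ▸ inf_le_left)))
  exact (TwoSidedIdeal.eq_of_le_of_forall_exists inf_le_left htop hcod).symm.trans
    (TwoSidedIdeal.eq_of_le_of_forall_exists inf_le_right (augmentationIdeal_ne_top hamen) hcod)

theorem isCStarCompletion_regularHom : IsCStarCompletion (regularHom Γ) :=
  ⟨regularHom_groupRingStar, regularHom_injective, denseRange_regularHom⟩

/-- Every C*-completion of the group ring is isomorphic to `C*_r(Γ)`: the kernel of the canonical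
map from `C*_r(Γ)` is a closed ideal that meets `ℂΓ` trivially, so it is neither the augmentation
ideal nor the whole algebra. -/
theorem exists_starAlgEquiv_of_isCStarCompletion [Infinite Γ] (hamen : IsAmenableGroup Γ)
    (hISR : HasCStarISR Γ) {A : Type u} [CStarAlgebra A] {ι : MonoidAlgebra ℂ Γ →ₐ[ℂ] A}
    (hι : IsCStarCompletion ι) : ∃ e : reducedCStar Γ ≃⋆ₐ[ℂ] A, ∀ x, e (regularHom Γ x) = ι x := by
  obtain ⟨ρ, hρ⟩ := hamen.exists_starAlgHom ι hι.map_star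
  have hzero : ∀ x, regularHom Γ x ∈ TwoSidedIdeal.ker ρ → x = 0 := fun x hx => by
    rw [TwoSidedIdeal.mem_ker, hρ] at hx
    exact hι.injective (hx.trans (map_zero ι).symm)
  have hinj : Function.Injective ρ := by
    rw [← TwoSidedIdeal.ker_eq_bot]
    by_contra hbot
    have htop : TwoSidedIdeal.ker ρ ≠ ⊤ := fun h =>
      one_ne_zero (hzero 1 (h ▸ TwoSidedIdeal.mem_top _))
    have haug := eq_augmentationIdeal hamen hISR (TwoSidedIdeal.isClosed_ker ρ) hbot htop
    obtain ⟨g, hg⟩ := exists_ne (1 : Γ)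
    have h1 := hzero (MonoidAlgebra.single g 1 - MonoidAlgebra.single 1 1) (by
      rw [haug, map_sub, regularHom_single, regularHom_single, one_smul, one_smul]
      exact reducedUnitary_sub_mem_augmentationIdeal g)
    have h2 := congrArg (fun x : MonoidAlgebra ℂ Γ => x.coeff g) h1
    simp [MonoidAlgebra.coeff_single, hg.symm] at h2
  have hsurj : Function.Surjective ρ := by
    have hcl : IsClosed (Set.range ρ) :=
      (NonUnitalStarAlgHom.isometry ρ hinj).isClosedEmbedding.isClosed_range
    rw [← Set.range_eq_univ, ← hcl.closure_eq]
    refine (hι.denseRange.mono ?_).closure_eq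
    rintro _ ⟨x, rfl⟩
    exact ⟨_, hρ x⟩
  exact ⟨StarAlgEquiv.ofBijective ρ ⟨hinj, hsurj⟩, hρ⟩

end ReducedIdeals

end

theorem mainTheorem5 (Γ : Type u) [Group Γ] [Countable Γ] [Infinite Γ]
    (hamen : IsAmenableGroup Γ) (hISR : HasCStarISR Γ) :
    {I : TwoSidedIdeal (reducedCStar Γ) |
        IsClosed (I : Set (reducedCStar Γ)) ∧ I ≠ ⊥ ∧ I ≠ ⊤} = {augmentationIdeal Γ} ∧
    (∃ ε : reducedCStar Γ →⋆ₐ[ℂ] ℂ, (∀ g : Γ, ε (reducedUnitary g) = 1) ∧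
      ∀ a : reducedCStar Γ, a ∈ augmentationIdeal Γ ↔ ε a = 0) ∧
    HasUniqueCStarCompletion Γ := by
  refine ⟨?_, hamen.exists_trivial_character, ?_, ?_⟩
  · ext I
    refine ⟨fun h => eq_augmentationIdeal hamen hISR h.1 h.2.1 h.2.2, ?_⟩
    rintro rfl
    refine ⟨isClosed_augmentationIdeal, fun hbot => ?_, augmentationIdeal_ne_top hamen⟩
    exact inf_augmentationIdeal_ne_bot (exists_sub_algebraMap_mem_augmentationIdeal (Γ := Γ))
      (by rw [inf_idem, hbot])
  · exact ⟨reducedCStar Γ, inferInstance, regularHom Γ, isCStarCompletion_regularHom⟩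
  · intro A B _ _ ι κ hι hκ
    obtain ⟨e, he⟩ := exists_starAlgEquiv_of_isCStarCompletion hamen hISR hι
    obtain ⟨f, hf⟩ := exists_starAlgEquiv_of_isCStarCompletion hamen hISR hκ
    exact ⟨e.symm.trans f, fun x => by
      rw [StarAlgEquiv.trans_apply, ← he, StarAlgEquiv.symm_apply_apply, hf]⟩
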